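/- Let $h\ge 0$ be an integer, $\nu\in(0,1)$, and let $\{S(t):t\geq 0\}$ be an $\mathbb{R}^h$-valued Lévy process (started at $0$, with independent and stationary increments and almost surely càdlàg paths) such that $\mathbb{E}[e^{\langle\theta,S(1)\rangle}]<\infty$ for all $\theta$ in a neighborhood of $0\in\mathbb{R}^h$. Put $\kappa_S(\theta):=\log\mathbb{E}[e^{\langle\theta,S(1)\rangle}]$, and let $Q$ be the Hessian matrix of $\kappa_S$ at $0$ (which is the covariance matrix of $S(1)$). Let $\{L_\nu(t):t\geq 0\}$ be an inverse $\nu$-stable subordinator independent of $\{S(t):t\ge 0\}$, i.e. $L_\nu(t)=\inf\{s\geq 0:D_\nu(s)>t\}$, where $\{D_\nu(s):s\ge0\}$ is a nondecreasing real-valued Lévy process with $\mathbb{E}[e^{-\lambda D_\nu(s)}]=e^{-s\lambda^\nu}$ for all $s,\lambda\geq 0$. Define $\alpha(\nu):=1-\nu/2$ if $\nabla\kappa_S(0)=0$ and $\alpha(\nu):=1-\nu$ if $\nabla\kappa_S(0)\neq 0$. Then, as $t\to\infty$: (i) if $\nabla\kappa_S(0)=0$, then $t^{\alpha(\nu)}\frac{S(L_\nu(t))}{t}$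 converges weakly to a random vector $Z$ such that, given $L_\nu(1)$, $Z$ is Gaussian distributed with mean $0\in\mathbb{R}^h$ and covariance matrix $Q\,L_\nu(1)$ (where $Z$ is defined on a possibly different probability space, together with a copy of $L_\nu(1)$); (ii) if $\nabla\kappa_S(0)\neq 0$, then $t^{\alpha(\nu)}\frac{S(L_\nu(t))}{t}$ converges weakly to $\nabla\kappa_S(0)L_\nu(1)$. -/

import Mathlib

open MeasureTheory ProbabilityTheory Filter Topology
open scoped NNReal

/-- A Lévy process `(X t)_{t ≥ 0}`: it starts at `0`, has independent and stationary increments,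
and almost surely has càdlàg paths. (Stochastic continuity follows from these properties.) -/
structure IsLevyProcess {Ω E : Type*} [MeasurableSpace Ω] [NormedAddCommGroup E]
    [MeasurableSpace E] (X : ℝ≥0 → Ω → E) (P : Measure Ω) : Prop where
  measurable : ∀ t, Measurable (X t)
  start_zero : ∀ᵐ ω ∂P, X 0 ω = 0
  indepIncrements : HasIndepIncrements X P
  stationaryIncrements : ∀ s t : ℝ≥0, IdentDistrib (fun ω => X (s + t) ω - X s ω) (X t) P P
  cadlag : ∀ᵐ ω ∂P, ∀ t : ℝ≥0,
    ContinuousWithinAt (fun s => X s ω) (Set.Ici t) t ∧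
      ∃ l : E, Tendsto (fun s => X s ω) (𝓝[<] t) (𝓝 l)

/-- A (standard) `ν`-stable subordinator: a real Lévy process with nondecreasing paths and Laplace
transform `𝔼[exp (-lam * D t)] = exp (-t * lam ^ ν)` for `lam ≥ 0`. -/
structure IsStableSubordinator {Ω : Type*} [MeasurableSpace Ω] (ν : ℝ) (D : ℝ≥0 → Ω → ℝ)
    (P : Measure Ω) : Prop where
  isLevy : IsLevyProcess D P
  monotone : ∀ᵐ ω ∂P, Monotone (fun t => D t ω)
  laplace : ∀ (t : ℝ≥0) (lam : ℝ), 0 ≤ lam →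
    ∫ ω, Real.exp (-lam * D t ω) ∂P = Real.exp (-(t : ℝ) * lam ^ ν)

/-- An inverse `ν`-stable subordinator: `L t = inf {s ≥ 0 : D s > t}` for some `ν`-stable
subordinator `D`. (The set is almost surely nonempty for all `t`.) -/
structure IsInverseStableSubordinator {Ω : Type*} [MeasurableSpace Ω] (ν : ℝ)
    (L : ℝ≥0 → Ω → ℝ≥0) (P : Measure Ω) : Prop where
  measurable : ∀ t, Measurable (L t)
  exists_subordinator : ∃ D : ℝ≥0 → Ω → ℝ, IsStableSubordinator ν D P ∧
    ∀ᵐ ω ∂P, ∀ t : ℝ≥0, L t ω = sInf {s : ℝ≥0 | (t : ℝ) < D s ω}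

/-- The cumulant generating function `κ θ = log 𝔼[exp ⟪θ, X⟫]` of a random vector (meaningful where
the expectation is finite). -/
noncomputable def vectorCgf {Ω : Type*} [MeasurableSpace Ω] {h : ℕ}
    (X : Ω → EuclideanSpace ℝ (Fin h)) (P : Measure Ω) (θ : EuclideanSpace ℝ (Fin h)) : ℝ :=
  Real.log (∫ ω, Real.exp (inner ℝ θ (X ω)) ∂P)

/-- The Hessian matrix of `f` at `x`. -/
noncomputable def hessianMatrix {h : ℕ} (f : EuclideanSpace ℝ (Fin h) → ℝ)
    (x : EuclideanSpace ℝ (Fin h)) : Matrix (Fin h) (Fin h) ℝ :=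
  Matrix.of fun i j =>
    fderiv ℝ (fderiv ℝ f) x (EuclideanSpace.single i 1) (EuclideanSpace.single j 1)

open Classical in
/-- The exponent `α(ν)`, which depends on whether the gradient `m = ∇κ_S(0)` vanishes. -/
noncomputable def scalingExponent {h : ℕ} (ν : ℝ) (m : EuclideanSpace ℝ (Fin h)) : ℝ :=
  if m = 0 then 1 - ν / 2 else 1 - ν

open scoped MatrixOrder in
theorem cfcSqrt_smul_matrix {h : ℕ} (Q : Matrix (Fin h) (Fin h) ℝ) (l : ℝ≥0) :
    CFC.sqrt ((l : ℝ) • Q) = Real.sqrt l • CFC.sqrt Q := by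
  by_cases hQ : 0 ≤ Q
  · have h1 : (0 : Matrix (Fin h) (Fin h) ℝ) ≤ Real.sqrt l • CFC.sqrt Q :=
      Matrix.nonneg_iff_posSemidef.2
        ((Matrix.nonneg_iff_posSemidef.1 (CFC.sqrt_nonneg Q)).smul (Real.sqrt_nonneg _))
    refine CFC.sqrt_unique ?_ h1
    rw [smul_mul_smul_comm, CFC.sqrt_mul_sqrt_self Q hQ, Real.mul_self_sqrt l.coe_nonneg]
  · have key : ∀ A : Matrix (Fin h) (Fin h) ℝ, ¬ 0 ≤ A → CFC.sqrt A = 0 := by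
      intro A hA
      rw [CFC.sqrt, cfcₙ_apply_of_not_predicate A hA]
    rcases eq_or_ne l 0 with rfl | hl
    · simp
    · rw [key Q hQ, smul_zero]
      refine key _ fun hlQ => hQ ?_
      have h2 := (Matrix.nonneg_iff_posSemidef.1 hlQ).smul (a := (l : ℝ)⁻¹) (by positivity)
      rw [smul_smul, inv_mul_cancel₀ (by exact_mod_cast hl), one_smul] at h2
      exact Matrix.nonneg_iff_posSemidef.2 h2

open scoped MatrixOrder in
theorem measurable_multivariateGaussian_smul {h : ℕ} (Q : Matrix (Fin h) (Fin h) ℝ) :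
    Measurable fun l : ℝ≥0 => multivariateGaussian 0 ((l : ℝ) • Q) := by
  have hm : Measurable fun p : ℝ≥0 × EuclideanSpace ℝ (Fin h) =>
      Real.sqrt p.1 • Matrix.toEuclideanCLM (𝕜 := ℝ) (CFC.sqrt Q) p.2 := by fun_prop
  refine Measure.measurable_of_measurable_coe _ fun s hs => ?_
  have heq : ∀ l : ℝ≥0, multivariateGaussian 0 ((l : ℝ) • Q) s =
      stdGaussian (EuclideanSpace ℝ (Fin h)) (Prod.mk l ⁻¹'
        ((fun p : ℝ≥0 × EuclideanSpace ℝ (Fin h) =>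
          Real.sqrt p.1 • Matrix.toEuclideanCLM (𝕜 := ℝ) (CFC.sqrt Q) p.2) ⁻¹' s)) := by
    intro l
    rw [multivariateGaussian, Measure.map_apply (by fun_prop) hs, cfcSqrt_smul_matrix]
    congr 1
    ext x
    simp
  simp_rw [heq]
  exact measurable_measure_prodMk_left (hm hs)

/-- The Markov kernel `l ↦ N(0, l Q)` of centered Gaussian laws with covariance matrix `l Q`
(for `Q` positive semidefinite). -/
noncomputable def gaussianScaleKernel {h : ℕ} (Q : Matrix (Fin h) (Fin h) ℝ) :
    Kernel ℝ≥0 (EuclideanSpace ℝ (Fin h)) where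
  toFun l := multivariateGaussian 0 ((l : ℝ) • Q)
  measurable' := measurable_multivariateGaussian_smul Q

instance {h : ℕ} (Q : Matrix (Fin h) (Fin h) ℝ) : IsMarkovKernel (gaussianScaleKernel Q) :=
  ⟨fun l => inferInstanceAs (IsProbabilityMeasure (multivariateGaussian 0 ((l : ℝ) • Q)))⟩

/-! Everything is done with characteristic functions. Write φ_s for that of S(s) and put r = t^ν. An
inverse stable subordinator satisfies L(t) ~ t^ν L(1) in law, so conditioning on the independent
time L(t) gives, for the process scaled by t^(-νδ), the characteristic function ∫ φ_{rl}(r^(-δ) ξ)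
dμ(l) at ξ, with μ the law of L(1).

Independent stationary increments give φ_{rl} = φ_1^⌊rl⌋ times a factor for a time in [0, 1], and
that factor tends to 1 at vanishing frequencies. Hence, if r (φ_1(r^(-δ) ξ) - 1) → ψ(ξ), the
integrand tends to exp(l ψ(ξ)); it is bounded by 1, so dominated convergence and Lévy's continuity
theorem finish (`tendsto_charFun_timeChanged`, `tendstoInDistribution_timeChanged`).

A second order Taylor expansion supplies ψ. In the centered case δ = 1/2 and ψ(ξ) = -⟨ξ, Qξ⟩/2, so
the limit is a Gaussian mixture; otherwise δ = 1 and ψ(ξ) = i⟨ξ, ∇κ_S(0)⟩, a law of large numbers.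
In both cases α(ν) = 1 - νδ. `vectorCgf_derivatives` identifies the moments with derivatives of κ_S.
-/

/-! ### Uniqueness for Laplace transforms -/

/-- The characteristic function of a law on `[0, ∞)` is the boundary value of its complex
moment generating function, taken from the left half-plane. -/
theorem tendsto_complexMGF_charFun {μ : Measure ℝ} [IsFiniteMeasure μ] (hμ : ∀ᵐ x ∂μ, 0 ≤ x)
    (t : ℝ) :
    Tendsto (fun ε : ℝ => complexMGF id μ (-ε + t * Complex.I)) (𝓝[>] 0) (𝓝 (charFun μ t)) := by
  rw [charFun_apply_real]
  refine tendsto_integral_filter_of_dominated_convergence (fun _ => 1) ?_ ?_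
    (integrable_const _) ?_
  · exact Eventually.of_forall fun ε => by fun_prop
  · filter_upwards [self_mem_nhdsWithin] with ε hε
    filter_upwards [hμ] with x hx
    rw [Complex.norm_exp]
    simpa using mul_nonneg (le_of_lt hε) hx
  · refine ae_of_all _ fun x => ?_
    have : Continuous fun ε : ℝ => Complex.exp ((-ε + t * Complex.I) * (x : ℂ)) := by fun_prop
    have h := (this.tendsto 0).mono_left (nhdsWithin_le_nhds (s := Set.Ioi 0))
    have he : Complex.exp (t * x * Complex.I) =
        Complex.exp ((-((0 : ℝ) : ℂ) + t * Complex.I) * (x : ℂ)) := by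
      rw [Complex.ofReal_zero, neg_zero, zero_add]
      ring_nf
    rw [he]
    exact h

theorem Iio_subset_integrableExpSet {μ : Measure ℝ} [IsFiniteMeasure μ] (hμ : ∀ᵐ x ∂μ, 0 ≤ x) :
    Set.Iio 0 ⊆ interior (integrableExpSet id μ) := by
  refine interior_maximal (fun u hu => ?_) isOpen_Iio
  refine Integrable.of_bound (C := 1) (by fun_prop) ?_
  filter_upwards [hμ] with x hx
  rw [Real.norm_eq_abs, Real.abs_exp, Real.exp_le_one_iff]
  exact mul_nonpos_of_nonpos_of_nonneg (le_of_lt hu) hx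

/-- Laws on `[0, ∞)` are determined by their Laplace transforms. -/
theorem ext_of_laplace {μ μ' : Measure ℝ} [IsFiniteMeasure μ] [IsFiniteMeasure μ']
    (hμ : ∀ᵐ x ∂μ, 0 ≤ x) (hμ' : ∀ᵐ x ∂μ', 0 ≤ x)
    (h : ∀ lam : ℝ, 0 ≤ lam → ∫ x, Real.exp (-lam * x) ∂μ = ∫ x, Real.exp (-lam * x) ∂μ') :
    μ = μ' := by
  have hX : AnalyticOnNhd ℂ (complexMGF id μ) {z | z.re < 0} :=
    analyticOnNhd_complexMGF.mono fun z hz => Iio_subset_integrableExpSet hμ hz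
  have hY : AnalyticOnNhd ℂ (complexMGF id μ') {z | z.re < 0} :=
    analyticOnNhd_complexMGF.mono fun z hz => Iio_subset_integrableExpSet hμ' hz
  have heq : Set.EqOn (complexMGF id μ) (complexMGF id μ') {z | z.re < 0} := by
    refine AnalyticOnNhd.eqOn_of_preconnected_of_frequently_eq hX hY
      (convex_halfSpace_re_lt 0).isPreconnected (z₀ := ((-1 : ℝ) : ℂ)) (by simp) ?_
    -- The hypothesis gives equality on the negative real axis; any point of it can serve as the
    -- accumulation point in the identity theorem.
    have h1 : ∃ᶠ x : ℝ in 𝓝[≠] (-1), complexMGF id μ x = complexMGF id μ' x := by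
      refine Eventually.frequently ?_
      filter_upwards [nhdsWithin_le_nhds (Iio_mem_nhds (show (-1 : ℝ) < 0 by norm_num))] with x hx
      rw [complexMGF_ofReal, complexMGF_ofReal]
      have := h (-x) (by simpa using hx.le)
      simp only [neg_neg] at this
      simp only [mgf, id, this]
    have h2 : Tendsto (fun x : ℝ => (x : ℂ)) (𝓝[≠] (-1)) (𝓝[≠] ((-1 : ℝ) : ℂ)) :=
      tendsto_nhdsWithin_of_tendsto_nhds_of_eventually_within _
        ((Complex.continuous_ofReal.tendsto _).mono_left nhdsWithin_le_nhds)
        (by filter_upwards [self_mem_nhdsWithin] with x hx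
            simpa using fun h' => hx (by exact_mod_cast h'))
    exact h2.frequently h1
  refine Measure.ext_of_charFun (funext fun t => ?_)
  refine tendsto_nhds_unique (tendsto_complexMGF_charFun hμ t)
    ((tendsto_complexMGF_charFun hμ' t).congr' ?_)
  filter_upwards [self_mem_nhdsWithin] with ε hε
  exact (heq (by simpa using hε)).symm

/-! ### Stable subordinators, their inverses and self-similarity -/

section Subordinator

variable {Ω : Type*} [MeasurableSpace Ω] {P : Measure Ω} {ν : ℝ}

theorem IsStableSubordinator.ae_nonneg {D : ℝ≥0 → Ω → ℝ} (hD : IsStableSubordinator ν D P)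
    (s : ℝ≥0) : ∀ᵐ ω ∂P, 0 ≤ D s ω := by
  filter_upwards [hD.monotone, hD.isLevy.start_zero] with ω h1 h2
  rw [← h2]
  exact h1 (zero_le)

/-- Self-similarity of the one-dimensional marginals of a stable subordinator. -/
theorem IsStableSubordinator.map_eq_map_mul [IsProbabilityMeasure P] {D : ℝ≥0 → Ω → ℝ}
    (hν : 0 < ν) (hD : IsStableSubordinator ν D P) (s : ℝ≥0) :
    P.map (D s) = P.map (fun ω => (s : ℝ) ^ ν⁻¹ * D 1 ω) := by
  have m := hD.isLevy.measurable
  have hp : 0 ≤ (s : ℝ) ^ ν⁻¹ := by positivity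
  have m' : Measurable fun ω => (s : ℝ) ^ ν⁻¹ * D 1 ω := (m 1).const_mul _
  refine ext_of_laplace ?_ ?_ fun lam hlam => ?_
  · rw [ae_map_iff (m s).aemeasurable measurableSet_Ici]
    exact hD.ae_nonneg s
  · rw [ae_map_iff m'.aemeasurable measurableSet_Ici]
    filter_upwards [hD.ae_nonneg 1] with ω h using mul_nonneg hp h
  · rw [integral_map (m s).aemeasurable (by fun_prop), integral_map m'.aemeasurable (by fun_prop),
      hD.laplace s lam hlam]
    have := hD.laplace 1 (lam * (s : ℝ) ^ ν⁻¹) (by positivity)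
    rw [Real.mul_rpow hlam hp, ← Real.rpow_mul s.coe_nonneg, inv_mul_cancel₀ hν.ne',
      Real.rpow_one] at this
    simp only [neg_mul, mul_assoc] at this ⊢
    rw [this]
    simp [mul_comm]

/-- Chernoff's bound with exponent -1 gives P(D n ≤ t) ≤ e^(t - n). This excludes the default value
`sInf ∅ = 0`, which would spoil the duality between L and D. -/
theorem IsStableSubordinator.ae_exists_gt [IsProbabilityMeasure P] {D : ℝ≥0 → Ω → ℝ}
    (hD : IsStableSubordinator ν D P) : ∀ᵐ ω ∂P, ∀ t : ℝ≥0, ∃ s, (t : ℝ) < D s ω := by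
  have m := hD.isLevy.measurable
  have key : ∀ t : ℕ, ∀ᵐ ω ∂P, ∃ s, (t : ℝ) < D s ω := by
    intro t
    have hbound : ∀ n : ℕ, P.real {ω | D n ω ≤ t} ≤ Real.exp t * Real.exp (-(n : ℝ)) := by
      intro n
      have hint : Integrable (fun ω => Real.exp (-1 * D n ω)) P := by
        refine Integrable.of_bound (C := 1) ((m n).const_mul _).exp.aestronglyMeasurable ?_
        filter_upwards [hD.ae_nonneg n] with ω h
        simpa using h
      have h1 := measure_le_le_exp_mul_mgf (X := D n) (μ := P) (t := -1) (t : ℝ) (by norm_num) hint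
      have h2 := hD.laplace n 1 zero_le_one
      simp only [mgf] at h1
      rw [h2] at h1
      simpa using h1
    have hlim : Tendsto (fun n : ℕ => Real.exp t * Real.exp (-(n : ℝ))) atTop (𝓝 0) := by
      simpa using (Real.tendsto_exp_neg_atTop_nhds_zero.comp
        tendsto_natCast_atTop_atTop).const_mul (Real.exp t)
    rw [ae_iff]
    have hle : P.real {ω | ¬∃ s, (t : ℝ) < D s ω} ≤ 0 := by
      refine ge_of_tendsto' hlim fun n => le_trans (measureReal_mono ?_) (hbound n)
      intro ω hω
      simp only [Set.mem_ofPred_eq, not_exists, not_lt] at hω ⊢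
      exact hω n
    exact (measureReal_eq_zero_iff).1 (le_antisymm hle measureReal_nonneg)
  filter_upwards [ae_all_iff.2 key] with ω hω t
  obtain ⟨n, hn⟩ := exists_nat_ge (t : ℝ)
  obtain ⟨s, hs⟩ := hω n
  exact ⟨s, hn.trans_lt hs⟩

/-- Two finite laws on the line that are sandwiched by the same function agree. -/
theorem measure_eq_of_sandwich {μ μ' : Measure ℝ} [IsFiniteMeasure μ] [IsFiniteMeasure μ']
    (huniv : μ (Set.Iio 0) = 0) (huniv' : μ' (Set.Iio 0) = 0) (g : ℝ → ENNReal)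
    (h1 : ∀ x, 0 < x → μ (Set.Iio x) ≤ g x ∧ g x ≤ μ (Set.Iic x))
    (h2 : ∀ x, 0 < x → μ' (Set.Iio x) ≤ g x ∧ g x ≤ μ' (Set.Iic x)) : μ = μ' := by
  -- One inequality between distribution functions: bound ρ(-∞, x] by ρ'(-∞, x + 1/(n + 1)] through
  -- `g`, then use right continuity of the latter.
  have aux : ∀ ρ ρ' : Measure ℝ, IsFiniteMeasure ρ → IsFiniteMeasure ρ' →
      (∀ x, 0 < x → ρ (Set.Iio x) ≤ g x) → (∀ x, 0 < x → g x ≤ ρ' (Set.Iic x)) →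
      ∀ x, 0 ≤ x → ρ (Set.Iic x) ≤ ρ' (Set.Iic x) := by
    intro ρ ρ' _ _ ha hb x hx
    have hinter : Set.Iic x = ⋂ n : ℕ, Set.Iic (x + 1 / ((n : ℝ) + 1)) := by
      ext y
      simp only [Set.mem_Iic, Set.mem_iInter]
      refine ⟨fun h n => h.trans (by simp; positivity), fun h => ?_⟩
      refine ge_of_tendsto' (x := atTop) (f := fun n : ℕ => x + 1 / ((n : ℝ) + 1)) ?_ h
      simpa using tendsto_one_div_add_atTop_nhds_zero_nat.const_add x
    have hanti : Antitone fun n : ℕ => Set.Iic (x + 1 / ((n : ℝ) + 1)) := by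
      intro a b hab
      refine Set.Iic_subset_Iic.2 (add_le_add_right ?_ _)
      exact one_div_le_one_div_of_le (by positivity) (by gcongr)
    have hlim := tendsto_measure_iInter_atTop (μ := ρ')
      (fun n : ℕ => (measurableSet_Iic (a := x + 1 / ((n : ℝ) + 1))).nullMeasurableSet) hanti
      ⟨0, measure_ne_top _ _⟩
    rw [← hinter] at hlim
    refine ge_of_tendsto' hlim fun n => ?_
    have hn : x < x + 1 / ((n : ℝ) + 1) := by simp; positivity
    exact (measure_mono (Set.Iic_subset_Iio.2 hn)).trans
      ((ha _ (hx.trans_lt hn)).trans (hb _ (hx.trans_lt hn)))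
  refine Measure.ext_of_Iic _ _ fun x => ?_
  rcases le_or_gt 0 x with hx | hx
  · exact le_antisymm
      (aux μ μ' inferInstance inferInstance (fun y hy => (h1 y hy).1) (fun y hy => (h2 y hy).2) x hx)
      (aux μ' μ inferInstance inferInstance (fun y hy => (h2 y hy).1) (fun y hy => (h1 y hy).2) x hx)
  · rw [measure_mono_null (Set.Iic_subset_Iio.2 hx) huniv,
      measure_mono_null (Set.Iic_subset_Iio.2 hx) huniv']

/-- Self-similarity of the one-dimensional marginals of an inverse stable subordinator. -/
theorem IsInverseStableSubordinator.map_eq_map_mul [IsProbabilityMeasure P] {L : ℝ≥0 → Ω → ℝ≥0}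
    (hν : 0 < ν) (hL : IsInverseStableSubordinator ν L P) {t : ℝ≥0} (ht : 0 < t) :
    P.map (L t) = P.map (fun ω => t ^ ν * L 1 ω) := by
  obtain ⟨D, hD, hLD⟩ := hL.exists_subordinator
  have mL := hL.measurable
  have mD := hD.isLevy.measurable
  -- Duality of a monotone path and its inverse. At s = L t the value D s may or may not exceed t,
  -- so the two events are only sandwiched, not equal.
  have hsub : ∀ t : ℝ≥0, ∀ᵐ ω ∂P, ∀ s, (L t ω < s → (t : ℝ) < D s ω) ∧
      ((t : ℝ) < D s ω → L t ω ≤ s) := by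
    intro t
    filter_upwards [hLD, hD.monotone, hD.ae_exists_gt] with ω h1 h2 h3 s
    rw [h1 t]
    refine ⟨fun h => ?_, fun h => csInf_le (OrderBot.bddBelow _) h⟩
    obtain ⟨s', hs', hlt⟩ := exists_lt_of_csInf_lt (h3 t) h
    exact lt_of_lt_of_le hs' (h2 hlt.le)
  have htν : 0 < t ^ ν := NNReal.rpow_pos ht
  have hcoe : Function.Injective (Measure.map (fun x : ℝ≥0 => (x : ℝ))) := by
    intro ρ ρ' h
    have he : MeasurableEmbedding (fun x : ℝ≥0 => (x : ℝ)) :=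
      MeasurableEmbedding.subtype_coe measurableSet_Ici
    ext s hs
    have h' := congrArg (fun m => m ((fun x : ℝ≥0 => (x : ℝ)) '' s)) h
    simpa only [he.map_apply, Set.preimage_image_eq _ he.injective] using h'
  apply hcoe
  rw [Measure.map_map measurable_coe_nnreal_real (mL t),
    Measure.map_map measurable_coe_nnreal_real ((mL 1).const_mul _)]
  have m1 : Measurable ((fun x : ℝ≥0 => (x : ℝ)) ∘ L t) := measurable_coe_nnreal_real.comp (mL t)
  have m2 : Measurable ((fun x : ℝ≥0 => (x : ℝ)) ∘ fun ω => t ^ ν * L 1 ω) :=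
    measurable_coe_nnreal_real.comp ((mL 1).const_mul _)
  -- The common function is x ↦ P(D x > t): duality at time t sandwiches it for L t, and
  -- self-similarity of D turns it into duality at time 1 for t^ν L 1.
  refine measure_eq_of_sandwich ?_ ?_ (fun x => P {ω | (t : ℝ) < D x.toNNReal ω}) ?_ ?_
  · rw [Measure.map_apply m1 measurableSet_Iio]
    convert measure_empty (μ := P)
    ext ω; simp
  · rw [Measure.map_apply m2 measurableSet_Iio]
    convert measure_empty (μ := P)
    ext ω
    simp only [Set.mem_preimage, Function.comp, Set.mem_Iio, Set.mem_empty_iff_false, iff_false,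
      not_lt]
    positivity
  · intro x hx
    rw [Measure.map_apply m1 measurableSet_Iio, Measure.map_apply m1 measurableSet_Iic]
    constructor
    · refine measure_mono_ae ?_
      filter_upwards [hsub t] with ω h hω
      exact (h x.toNNReal).1 (by rw [Real.lt_toNNReal_iff_coe_lt]; exact hω)
    · refine measure_mono_ae ?_
      filter_upwards [hsub t] with ω h hω
      exact (Real.le_toNNReal_iff_coe_le hx.le).1 ((h x.toNNReal).2 hω)
  · intro x hx
    set y : ℝ≥0 := x.toNNReal / t ^ ν with hy
    have hxt : 0 < x.toNNReal := Real.toNNReal_pos.2 hx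
    -- Both sides reduce to D 1, and y^(1/ν) = x^(1/ν) / t.
    have hscale : P {ω | (t : ℝ) < D x.toNNReal ω} = P {ω | ((1 : ℝ≥0) : ℝ) < D y ω} := by
      have e1 : ∀ (s u : ℝ≥0), P {ω | (u : ℝ) < D s ω} =
          P {ω | (u : ℝ) < (s : ℝ) ^ ν⁻¹ * D 1 ω} := by
        intro s u
        have := congrArg (fun m => m (Set.Ioi (u : ℝ))) (hD.map_eq_map_mul hν s)
        rwa [Measure.map_apply (mD s) measurableSet_Ioi,
          Measure.map_apply ((mD 1).const_mul _) measurableSet_Ioi] at this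
      rw [e1, e1]
      congr 1
      ext ω
      simp only [Set.mem_ofPred_eq, hy, NNReal.coe_div, NNReal.coe_rpow, NNReal.coe_one]
      have ht' : (0 : ℝ) < t := ht
      rw [Real.div_rpow (by positivity) (by positivity), ← Real.rpow_mul ht'.le,
        mul_inv_cancel₀ hν.ne', Real.rpow_one, div_mul_eq_mul_div, lt_div_iff₀ ht', one_mul]
    rw [Measure.map_apply m2 measurableSet_Iio, Measure.map_apply m2 measurableSet_Iic, hscale]
    constructor
    · refine measure_mono_ae ?_
      filter_upwards [hsub 1] with ω h hω
      refine (h y).1 ?_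
      rw [hy, lt_div_iff₀ htν, mul_comm, Real.lt_toNNReal_iff_coe_lt]
      exact hω
    · refine measure_mono_ae ?_
      filter_upwards [hsub 1] with ω h hω
      have := (h y).2 hω
      rw [hy, le_div_iff₀ htν, mul_comm, Real.le_toNNReal_iff_coe_le hx.le] at this
      exact this

end Subordinator

/-! ### Lévy processes at random times and their characteristic functions -/

section Levy

variable {Ω : Type*} [MeasurableSpace Ω] {P : Measure Ω} {h : ℕ}
  {S : ℝ≥0 → Ω → EuclideanSpace ℝ (Fin h)}

/-- A function with right and left limits everywhere is bounded on compact sets. -/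
theorem exists_norm_le_of_cadlag {E : Type*} [NormedAddCommGroup E] {f : ℝ≥0 → E}
    (hf : ∀ t : ℝ≥0, ContinuousWithinAt f (Set.Ici t) t ∧ ∃ l : E, Tendsto f (𝓝[<] t) (𝓝 l))
    {K : Set ℝ≥0} (hK : IsCompact K) : ∃ C, ∀ t ∈ K, ‖f t‖ ≤ C := by
  refine hK.induction_on (p := fun s => ∃ C, ∀ t ∈ s, ‖f t‖ ≤ C) ⟨0, by simp⟩ ?_ ?_ ?_
  · rintro s t hst ⟨C, hC⟩
    exact ⟨C, fun u hu => hC u (hst hu)⟩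
  · rintro s t ⟨C, hC⟩ ⟨C', hC'⟩
    refine ⟨max C C', ?_⟩
    rintro u (hu | hu)
    · exact (hC u hu).trans (le_max_left _ _)
    · exact (hC' u hu).trans (le_max_right _ _)
  · intro t _
    obtain ⟨h1, l, h2⟩ := hf t
    have e1 : ∀ᶠ u in 𝓝[≥] t, ‖f u‖ ≤ ‖f t‖ + 1 :=
      (h1.norm.eventually (gt_mem_nhds (lt_add_one _))).mono fun _ hu => hu.le
    have e2 : ∀ᶠ u in 𝓝[<] t, ‖f u‖ ≤ ‖l‖ + 1 :=
      (h2.norm.eventually (gt_mem_nhds (lt_add_one _))).mono fun _ hu => hu.le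
    have e3 : ∀ᶠ u in 𝓝 t, ‖f u‖ ≤ max (‖f t‖ + 1) (‖l‖ + 1) := by
      rw [← nhdsLT_sup_nhdsGE, eventually_sup]
      exact ⟨e2.mono fun _ hu => hu.trans (le_max_right _ _),
        e1.mono fun _ hu => hu.trans (le_max_left _ _)⟩
    exact ⟨_, mem_nhdsWithin_of_mem_nhds e3, _, fun u hu => hu⟩

/-- Approximation of `l` from the right by points of the grid of mesh `1 / (n + 1)`. -/
noncomputable def gridApprox (n : ℕ) (l : ℝ≥0) : ℝ≥0 :=
  ((⌊l * (n + 1)⌋₊ : ℝ≥0) + 1) / (n + 1)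

theorem le_gridApprox (n : ℕ) (l : ℝ≥0) : l ≤ gridApprox n l := by
  rw [gridApprox, le_div_iff₀ (by positivity)]
  exact (Nat.lt_floor_add_one _).le

theorem gridApprox_le (n : ℕ) (l : ℝ≥0) : gridApprox n l ≤ l + 1 / (n + 1) := by
  rw [gridApprox, div_le_iff₀ (by positivity), add_mul, div_mul_cancel₀ _ (by positivity)]
  gcongr
  exact Nat.floor_le (zero_le)

theorem tendsto_gridApprox (l : ℝ≥0) :
    Tendsto (fun n => gridApprox n l) atTop (𝓝[≥] l) := by
  refine tendsto_nhdsWithin_iff.2 ⟨?_, Eventually.of_forall fun n => le_gridApprox n l⟩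
  refine tendsto_of_tendsto_of_tendsto_of_le_of_le tendsto_const_nhds ?_
    (fun n => le_gridApprox n l) (fun n => gridApprox_le n l)
  simpa using (tendsto_one_div_add_atTop_nhds_zero_nat (𝕜 := ℝ≥0)).const_add l

/-- Evaluation of a path at grid points is jointly measurable. -/
theorem measurable_eval_gridApprox {E : Type*} [MeasurableSpace E] (n : ℕ) :
    Measurable fun p : (ℝ≥0 → E) × ℝ≥0 => p.1 (gridApprox n p.2) := by
  have h1 : Measurable fun p : (ℝ≥0 → E) × ℕ => p.1 (((p.2 : ℝ≥0) + 1) / (n + 1)) :=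
    measurable_from_prod_countable_left fun k =>
      measurable_pi_apply (((k : ℝ≥0) + 1) / (n + 1))
  have h2 : Measurable fun p : (ℝ≥0 → E) × ℝ≥0 => (p.1, ⌊p.2 * ((n : ℝ≥0) + 1)⌋₊) :=
    measurable_fst.prodMk (Nat.measurable_floor.comp (measurable_snd.mul_const _))
  exact h1.comp h2

/-- The grid points lie to the right of `l`, the side on which càdlàg paths are continuous. -/
theorem IsLevyProcess.tendsto_gridApprox (hS : IsLevyProcess S P) :
    ∀ᵐ ω ∂P, ∀ l, Tendsto (fun n => S (gridApprox n l) ω) atTop (𝓝 (S l ω)) := by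
  filter_upwards [hS.cadlag] with ω hω l
  exact (hω l).1.tendsto.comp (_root_.tendsto_gridApprox l)

theorem IsLevyProcess.measurable_path (hS : IsLevyProcess S P) :
    Measurable fun ω t => S t ω := measurable_pi_lambda _ hS.measurable

/-- A Lévy process evaluated at a random time is a random vector. -/
theorem IsLevyProcess.aemeasurable_eval (hS : IsLevyProcess S P) {T : Ω → ℝ≥0}
    (hT : Measurable T) : AEMeasurable (fun ω => S (T ω) ω) P := by
  refine aemeasurable_of_tendsto_metrizable_ae atTop
    (f := fun n ω => S (gridApprox n (T ω)) ω) (fun n => ?_) ?_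
  · exact ((measurable_eval_gridApprox n).comp (hS.measurable_path.prodMk hT)).aemeasurable
  · filter_upwards [hS.tendsto_gridApprox] with ω hω using hω _

variable [IsProbabilityMeasure P]

theorem IsLevyProcess.tendsto_charFun_gridApprox (hS : IsLevyProcess S P)
    (ξ : EuclideanSpace ℝ (Fin h)) (l : ℝ≥0) :
    Tendsto (fun n => charFun (P.map (S (gridApprox n l))) ξ) atTop
      (𝓝 (charFun (P.map (S l)) ξ)) := by
  have m := hS.measurable
  simp only [charFun_apply]
  have e : ∀ t, ∫ x, Complex.exp (inner ℝ x ξ * Complex.I) ∂(P.map (S t)) =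
      ∫ ω, Complex.exp (inner ℝ (S t ω) ξ * Complex.I) ∂P := fun t =>
    integral_map (m t).aemeasurable (by fun_prop)
  simp only [e]
  refine tendsto_integral_of_dominated_convergence (fun _ => 1) (fun n => ?_)
    (integrable_const _) (fun n => ae_of_all _ fun ω => ?_) ?_
  · have := m (gridApprox n l)
    fun_prop
  · rw [Complex.norm_exp_ofReal_mul_I]
  · filter_upwards [hS.tendsto_gridApprox] with ω hω
    have hc : Continuous fun x : EuclideanSpace ℝ (Fin h) =>
      Complex.exp (inner ℝ x ξ * Complex.I) := by fun_prop
    exact (hc.tendsto _).comp (hω l)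

/-- Along the grid the function factors through a natural number, so it is measurable; measurability
passes to the pointwise limit. -/
theorem IsLevyProcess.measurable_charFun (hS : IsLevyProcess S P)
    (ξ : EuclideanSpace ℝ (Fin h)) : Measurable fun l => charFun (P.map (S l)) ξ := by
  refine measurable_of_tendsto_metrizable (f := fun n l => charFun (P.map (S (gridApprox n l))) ξ)
    (fun n => ?_) (tendsto_pi_nhds.2 fun l => hS.tendsto_charFun_gridApprox ξ l)
  have h1 : Measurable fun k : ℕ => charFun (P.map (S (((k : ℝ≥0) + 1) / (n + 1)))) ξ :=
    measurable_from_nat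
  have h2 : Measurable fun l : ℝ≥0 => ⌊l * ((n : ℝ≥0) + 1)⌋₊ :=
    Nat.measurable_floor.comp (measurable_id.mul_const _)
  exact h1.comp h2

theorem norm_charFun_map_le_one {X : Ω → EuclideanSpace ℝ (Fin h)} (hX : AEMeasurable X P)
    (ξ : EuclideanSpace ℝ (Fin h)) : ‖charFun (P.map X) ξ‖ ≤ 1 := by
  have := Measure.isProbabilityMeasure_map hX
  exact norm_charFun_le_one ξ

/-- The characteristic function of a Lévy process at an independent random time. -/
theorem IsLevyProcess.charFun_eval_indep (hS : IsLevyProcess S P) {T : Ω → ℝ≥0}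
    (hT : Measurable T) (hind : IndepFun (fun ω t => S t ω) T P)
    (ξ : EuclideanSpace ℝ (Fin h)) :
    charFun (P.map fun ω => S (T ω) ω) ξ = ∫ l, charFun (P.map (S l)) ξ ∂(P.map T) := by
  have hpath := hS.measurable_path
  have hTp : IsProbabilityMeasure (P.map T) := Measure.isProbabilityMeasure_map hT.aemeasurable
  have hSp : IsProbabilityMeasure (P.map fun ω t => S t ω) :=
    Measure.isProbabilityMeasure_map hpath.aemeasurable
  have hc : Continuous fun x : EuclideanSpace ℝ (Fin h) =>
    Complex.exp (inner ℝ x ξ * Complex.I) := by fun_prop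
  -- Evaluation (f, l) ↦ f l need not be measurable on the space of all paths, so Fubini is applied
  -- at grid times, where it is, and the mesh then tends to 0.
  have hgrid : ∀ n, ∫ ω, Complex.exp (inner ℝ (S (gridApprox n (T ω)) ω) ξ * Complex.I) ∂P =
      ∫ l, charFun (P.map (S (gridApprox n l))) ξ ∂(P.map T) := by
    intro n
    have hF : Measurable fun p : (ℝ≥0 → EuclideanSpace ℝ (Fin h)) × ℝ≥0 =>
        Complex.exp (inner ℝ (p.1 (gridApprox n p.2)) ξ * Complex.I) :=
      hc.measurable.comp (measurable_eval_gridApprox n)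
    have h1 := integral_map (μ := P) (hpath.prodMk hT).aemeasurable hF.aestronglyMeasurable
    rw [← h1, (indepFun_iff_map_prod_eq_prod_map_map hpath.aemeasurable hT.aemeasurable).1 hind,
      integral_prod_symm]
    · refine integral_congr_ae (ae_of_all _ fun l => ?_)
      simp only
      have m := hS.measurable (gridApprox n l)
      rw [charFun_apply, integral_map m.aemeasurable hc.aestronglyMeasurable]
      exact integral_map hpath.aemeasurable
        (hc.measurable.comp (measurable_pi_apply (gridApprox n l))).aestronglyMeasurable
    · refine Integrable.of_bound (C := 1) hF.aestronglyMeasurable (ae_of_all _ fun p => ?_)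
      rw [Complex.norm_exp_ofReal_mul_I]
  rw [charFun_apply, integral_map (hS.aemeasurable_eval hT) hc.aestronglyMeasurable]
  refine tendsto_nhds_unique
    (f := fun n => ∫ ω, Complex.exp (inner ℝ (S (gridApprox n (T ω)) ω) ξ * Complex.I) ∂P)
    (l := atTop) ?_ ?_
  · refine tendsto_integral_of_dominated_convergence (fun _ => 1) (fun n => ?_)
      (integrable_const _) (fun n => ae_of_all _ fun ω => ?_) ?_
    · exact (hc.measurable.comp ((measurable_eval_gridApprox n).comp
        (hpath.prodMk hT))).aestronglyMeasurable
    · rw [Complex.norm_exp_ofReal_mul_I]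
    · filter_upwards [hS.tendsto_gridApprox] with ω hω
      exact (hc.tendsto _).comp (hω _)
  · simp only [hgrid]
    refine tendsto_integral_of_dominated_convergence (fun _ => 1) (fun n => ?_)
      (integrable_const _) (fun n => ae_of_all _ fun l => ?_)
      (ae_of_all _ fun l => hS.tendsto_charFun_gridApprox ξ l)
    · have h2 : Measurable (gridApprox n) :=
        ((measurable_from_nat (f := fun k : ℕ => ((k : ℝ≥0) + 1) / (n + 1))).comp
          (Nat.measurable_floor.comp (measurable_id.mul_const ((n : ℝ≥0) + 1))))
      exact ((hS.measurable_charFun ξ).comp h2).aestronglyMeasurable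
    · exact norm_charFun_map_le_one (hS.measurable _).aemeasurable ξ

/-- S (s + t) is S s plus an independent increment distributed as S t. -/
theorem IsLevyProcess.charFun_add (hS : IsLevyProcess S P) (s t : ℝ≥0)
    (ξ : EuclideanSpace ℝ (Fin h)) :
    charFun (P.map (S (s + t))) ξ = charFun (P.map (S s)) ξ * charFun (P.map (S t)) ξ := by
  have m := hS.measurable
  have hi := hS.indepIncrements.indepFun_eval_sub (r := 0) (s := s) (t := s + t) (zero_le)
    le_self_add hS.start_zero
  have h1 := hi.charFun_map_add_eq_mul (m s).aemeasurable ((m _).sub (m s)).aemeasurable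
  have h2 : S s + (S (s + t) - S s) = S (s + t) := by abel
  have h3 : P.map (S (s + t) - S s) = P.map (S t) := (hS.stationaryIncrements s t).map_eq
  rw [h2, h3] at h1
  rw [h1]; rfl

theorem IsLevyProcess.charFun_natCast (hS : IsLevyProcess S P) (n : ℕ)
    (ξ : EuclideanSpace ℝ (Fin h)) :
    charFun (P.map (S n)) ξ = charFun (P.map (S 1)) ξ ^ n := by
  induction n with
  | zero =>
    have : S (0 : ℕ) =ᵐ[P] fun _ => 0 := by rw [Nat.cast_zero]; exact hS.start_zero
    rw [Measure.map_congr this, Measure.map_const]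
    simp
  | succ n ih => rw [Nat.cast_succ, hS.charFun_add, ih, pow_succ]

/-- On bounded time intervals, the characteristic functions of a Lévy process tend to `1` at
vanishing frequencies, uniformly in time. -/
theorem IsLevyProcess.tendsto_charFun_one (hS : IsLevyProcess S P) {ι : Type*} {l : Filter ι}
    [l.IsCountablyGenerated] {η : ι → EuclideanSpace ℝ (Fin h)} {u : ι → ℝ≥0}
    (hη : Tendsto η l (𝓝 0)) (hu : ∀ i, u i ≤ 1) :
    Tendsto (fun i => charFun (P.map (S (u i))) (η i)) l (𝓝 1) := by
  have m := hS.measurable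
  have e : ∀ i, charFun (P.map (S (u i))) (η i) =
      ∫ ω, Complex.exp (inner ℝ (S (u i) ω) (η i) * Complex.I) ∂P := fun i => by
    rw [charFun_apply]
    exact integral_map (m _).aemeasurable (by fun_prop)
  simp only [e]
  have h1 : (1 : ℂ) = ∫ _ω, (1 : ℂ) ∂P := by simp
  rw [h1]
  refine tendsto_integral_filter_of_dominated_convergence (fun _ => 1)
    (Eventually.of_forall fun i => ?_) (Eventually.of_forall fun i => ae_of_all _ fun ω => ?_)
    (integrable_const _) ?_
  · have := m (u i)
    fun_prop
  · rw [Complex.norm_exp_ofReal_mul_I]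
  · filter_upwards [hS.cadlag] with ω hω
    -- The times `u i` need not converge, so a bound for the path on all of [0, 1] replaces
    -- continuity.
    obtain ⟨C, hC⟩ := exists_norm_le_of_cadlag hω (isCompact_Icc (a := (0 : ℝ≥0)) (b := 1))
    have hz : Tendsto (fun i => (inner ℝ (S (u i) ω) (η i) : ℝ)) l (𝓝 0) := by
      refine squeeze_zero_norm (a := fun i => C * ‖η i‖) (fun i => ?_) ?_
      · exact (norm_inner_le_norm _ _).trans
          (mul_le_mul_of_nonneg_right (hC _ ⟨zero_le, hu i⟩) (norm_nonneg _))
      · simpa using hη.norm.const_mul C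
    have hc : Continuous fun x : ℝ => Complex.exp (x * Complex.I) := by fun_prop
    have := (hc.tendsto 0).comp hz
    simpa [Function.comp_def] using this

end Levy

/-! ### Rescaling limits -/

/-- Write z^n = exp(n log z) and n log z = n (z - 1) · (log z)/(z - 1); the last quotient tends to
log'(1) = 1. `dslope` makes it meaningful at z = 1 too. -/
theorem Complex.tendsto_pow_exp {ι : Type*} {l : Filter ι} {z : ι → ℂ} {n : ι → ℕ} {c : ℂ}
    (hz : Tendsto z l (𝓝 1)) (hn : Tendsto (fun i => (n i : ℂ) * (z i - 1)) l (𝓝 c)) :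
    Tendsto (fun i => z i ^ n i) l (𝓝 (Complex.exp c)) := by
  have hlog : HasDerivAt Complex.log 1 1 := by
    simpa using Complex.hasDerivAt_log (z := 1) (by simp)
  have hs : Tendsto (fun i => dslope Complex.log 1 (z i)) l (𝓝 1) := by
    have := (continuousAt_dslope_same.2 hlog.differentiableAt).tendsto.comp hz
    simpa [dslope_same, hlog.deriv, Function.comp_def] using this
  have h1 : Tendsto (fun i => (n i : ℂ) * Complex.log (z i)) l (𝓝 c) := by
    have h2 := hn.mul hs
    rw [mul_one] at h2
    refine h2.congr fun i => ?_
    have := sub_smul_dslope Complex.log 1 (z i)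
    simp only [smul_eq_mul, Complex.log_one, sub_zero] at this
    rw [mul_assoc, this]
  refine ((Complex.continuous_exp.tendsto c).comp h1).congr' ?_
  filter_upwards [hz.eventually_ne one_ne_zero] with i hi
  simp only [Function.comp]
  rw [Complex.exp_nat_mul, Complex.exp_log hi]

section Scaling

variable {Ω : Type*} [MeasurableSpace Ω] {P : Measure Ω} [IsProbabilityMeasure P] {h : ℕ}
  {S : ℝ≥0 → Ω → EuclideanSpace ℝ (Fin h)}

/-- Rescaling of time and space in a Lévy process. -/
theorem IsLevyProcess.tendsto_charFun_scaling (hS : IsLevyProcess S P) {ι : Type*} {k : Filter ι}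
    [k.IsCountablyGenerated] {η : ι → EuclideanSpace ℝ (Fin h)} {r : ι → ℝ≥0} {c : ℂ}
    (hη : Tendsto η k (𝓝 0)) (hr : Tendsto r k atTop)
    (hc : Tendsto (fun i => (r i : ℂ) * (charFun (P.map (S 1)) (η i) - 1)) k (𝓝 c)) (l : ℝ≥0) :
    Tendsto (fun i => charFun (P.map (S (r i * l))) (η i)) k (𝓝 (Complex.exp (l * c))) := by
  -- Split the time r l into its integer part, which gives a power, and a remainder in [0, 1], whose
  -- factor tends to 1.
  have hsplit : ∀ i, charFun (P.map (S (r i * l))) (η i) =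
      charFun (P.map (S 1)) (η i) ^ ⌊r i * l⌋₊ *
        charFun (P.map (S (r i * l - ⌊r i * l⌋₊))) (η i) := by
    intro i
    rw [← hS.charFun_natCast, ← hS.charFun_add, add_tsub_cancel_of_le (Nat.floor_le zero_le)]
  simp only [hsplit]
  rw [← mul_one (Complex.exp _)]
  refine Tendsto.mul (Complex.tendsto_pow_exp ?_ ?_) (hS.tendsto_charFun_one hη fun i => ?_)
  · exact hS.tendsto_charFun_one hη fun _ => le_rfl
  · have hrat : Tendsto (fun i => ((⌊(l : ℝ) * (r i : ℝ)⌋₊ : ℝ) / (r i : ℝ))) k (𝓝 l) :=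
      (tendsto_nat_floor_mul_div_atTop l.coe_nonneg).comp
        (NNReal.tendsto_coe_atTop.2 hr)
    have hratC : Tendsto (fun i => ((((⌊(l : ℝ) * (r i : ℝ)⌋₊ : ℝ) / (r i : ℝ) : ℝ)) : ℂ)) k
        (𝓝 ((l : ℝ) : ℂ)) := (Complex.continuous_ofReal.tendsto _).comp hrat
    refine (hratC.mul hc).congr' ?_
    filter_upwards [hr.eventually_gt_atTop 0] with i hi
    have hi' : ((r i : ℝ) : ℂ) ≠ 0 := by exact_mod_cast hi.ne'
    have hfl : ⌊(l : ℝ) * (r i : ℝ)⌋₊ = ⌊r i * l⌋₊ := by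
      rw [← NNReal.coe_mul, mul_comm]; exact Nonneg.nat_floor_coe _
    rw [hfl]
    push_cast
    field_simp
  · rw [tsub_le_iff_left]
    exact (Nat.lt_floor_add_one _).le

end Scaling

/-! ### Exponential moments and derivatives of the cumulant generating function -/

section Moments

variable {Ω : Type*} [MeasurableSpace Ω] {P : Measure Ω}

/-- Exponential moments near `0` make some exponential of the norm integrable. -/
theorem exists_integrable_exp_norm [IsFiniteMeasure P] {h : ℕ} {X : Ω → EuclideanSpace ℝ (Fin h)}
    (hX : AEMeasurable X P)
    (hκ : ∀ᶠ θ : EuclideanSpace ℝ (Fin h) in 𝓝 0,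
      Integrable (fun ω => Real.exp (inner ℝ θ (X ω))) P) :
    ∃ c > 0, Integrable (fun ω => Real.exp (c * ‖X ω‖)) P := by
  obtain ⟨r, hr, hball⟩ := Metric.eventually_nhds_iff.1 hκ
  -- Chosen so that c h < r, with the + 1 keeping c meaningful and positive when h = 0.
  set c : ℝ := r / (h + 1) with hc
  have hc0 : 0 < c := by positivity
  have hch : c * h < r := by
    rw [hc, div_mul_eq_mul_div, div_lt_iff₀ (by positivity)]
    nlinarith
  have hint : ∀ (i : Fin h) (a : ℝ), |a| = c * h →
      Integrable (fun ω => Real.exp (a * X ω i)) P := by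
    intro i a ha
    have := hball (y := EuclideanSpace.single i a) (by simpa [ha] using hch)
    simpa [EuclideanSpace.inner_single_left] using this
  refine ⟨c, hc0, ?_⟩
  have hsum : Integrable (fun ω => 1 + ∑ i : Fin h,
      (Real.exp (c * h * X ω i) + Real.exp (-(c * h) * X ω i))) P := by
    refine (integrable_const _).add (integrable_finsetSum _ fun i _ => ?_)
    have hpos : 0 ≤ c * h := by positivity
    exact (hint i _ (abs_of_nonneg hpos)).add (hint i _ (by rw [abs_neg, abs_of_nonneg hpos]))
  refine hsum.mono' (by fun_prop) (ae_of_all _ fun ω => ?_)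
  rw [Real.norm_eq_abs, Real.abs_exp]
  have hpos : ∀ i, 0 ≤ Real.exp (c * h * X ω i) + Real.exp (-(c * h) * X ω i) :=
    fun i => by positivity
  rcases isEmpty_or_nonempty (Fin h) with hh | hh
  · have : X ω = 0 := Subsingleton.elim _ _
    simp [this]
  · obtain ⟨i, hi⟩ := Finite.exists_max fun i => |X ω i|
    have hnorm : ‖X ω‖ ≤ h * |X ω i| := by
      calc ‖X ω‖ = ‖∑ j, EuclideanSpace.single j (X ω j)‖ := by
            congr 1
            ext k
            simp [Pi.single_apply]
        _ ≤ ∑ j, ‖EuclideanSpace.single j (X ω j)‖ := norm_sum_le _ _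
        _ ≤ ∑ _j : Fin h, |X ω i| := Finset.sum_le_sum fun j _ => by simpa using hi j
        _ = h * |X ω i| := by simp
    have h1 : Real.exp (c * ‖X ω‖) ≤
        Real.exp (c * h * X ω i) + Real.exp (-(c * h) * X ω i) := by
      have h2 : Real.exp (c * ‖X ω‖) ≤ Real.exp (c * h * |X ω i|) := by
        rw [Real.exp_le_exp, mul_assoc]
        gcongr
      refine h2.trans ?_
      rcases abs_cases (X ω i) with ⟨h3, _⟩ | ⟨h3, _⟩
      · rw [h3]
        exact le_add_of_nonneg_right (Real.exp_pos _).le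
      · rw [h3, mul_neg, neg_mul]
        exact le_add_of_nonneg_left (Real.exp_pos _).le
    have h4 := Finset.single_le_sum (fun j _ => hpos j) (Finset.mem_univ i)
    linarith

/-- Each factor ‖x‖ is traded for δ⁻¹ exp(δ ‖x‖), so k powers cost kδ in the exponent. -/
theorem norm_pow_mul_exp_le {E : Type*} [NormedAddCommGroup E] {δ : ℝ} (hδ : 0 < δ) (x : E)
    (k : ℕ) : ‖x‖ ^ k * Real.exp (δ * ‖x‖) ≤ (δ⁻¹) ^ k * Real.exp ((k + 1) * δ * ‖x‖) := by
  have h1 : ‖x‖ ≤ δ⁻¹ * Real.exp (δ * ‖x‖) := by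
    rw [inv_mul_eq_div, le_div_iff₀ hδ, mul_comm]
    linarith [Real.add_one_le_exp (δ * ‖x‖)]
  calc ‖x‖ ^ k * Real.exp (δ * ‖x‖)
      ≤ (δ⁻¹ * Real.exp (δ * ‖x‖)) ^ k * Real.exp (δ * ‖x‖) := by gcongr
    _ = (δ⁻¹) ^ k * Real.exp ((k + 1) * δ * ‖x‖) := by
      rw [mul_pow, ← Real.exp_nat_mul, mul_assoc, ← Real.exp_add]
      ring_nf

theorem integrable_norm_pow_mul_exp {E : Type*} [NormedAddCommGroup E] [MeasurableSpace E]
    [BorelSpace E] {X : Ω → E} (hX : AEMeasurable X P) {c δ : ℝ} (hδ : 0 < δ)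
    (hc : Integrable (fun ω => Real.exp (c * ‖X ω‖)) P) (k : ℕ) (hk : (k + 1) * δ ≤ c) :
    Integrable (fun ω => ‖X ω‖ ^ k * Real.exp (δ * ‖X ω‖)) P := by
  refine (hc.const_mul ((δ⁻¹) ^ k)).mono' ?_ (ae_of_all _ fun ω => ?_)
  · have : AEMeasurable (fun ω => ‖X ω‖ ^ k * Real.exp (δ * ‖X ω‖)) P := by fun_prop
    exact this.aestronglyMeasurable
  · rw [Real.norm_of_nonneg (by positivity)]
    refine (norm_pow_mul_exp_le hδ _ k).trans ?_
    gcongr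

/-- Differentiation under the expectation of `exp ⟪θ, X⟫ • g X`. -/
theorem hasFDerivAt_integral_exp_inner_smul {E F : Type*} [NormedAddCommGroup E]
    [InnerProductSpace ℝ E] [FiniteDimensional ℝ E] [MeasurableSpace E] [BorelSpace E]
    [NormedAddCommGroup F] [NormedSpace ℝ F] [FiniteDimensional ℝ F]
    {X : Ω → E} (hX : AEMeasurable X P) {g : E → F} (hg : Continuous g) {δ : ℝ}
    (h0 : Integrable (fun ω => Real.exp (δ * ‖X ω‖) * ‖g (X ω)‖) P)
    (h1 : Integrable (fun ω => ‖X ω‖ * Real.exp (δ * ‖X ω‖) * ‖g (X ω)‖) P)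
    {θ₀ : E} (hθ₀ : ‖θ₀‖ < δ) :
    HasFDerivAt (fun θ => ∫ ω, Real.exp (inner ℝ θ (X ω)) • g (X ω) ∂P)
      (∫ ω, Real.exp (inner ℝ θ₀ (X ω)) • (innerSL ℝ (X ω)).smulRight (g (X ω)) ∂P) θ₀ := by
  have hexp : ∀ (θ x : E), ‖θ‖ < δ → Real.exp (inner ℝ θ x) ≤ Real.exp (δ * ‖x‖) := by
    intro θ x hθ
    rw [Real.exp_le_exp]
    exact (real_inner_le_norm _ _).trans (by gcongr)
  have hmeas : ∀ θ : E, AEStronglyMeasurable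
      (fun ω => Real.exp (inner ℝ θ (X ω)) • g (X ω)) P := fun θ => by
    have : Continuous fun x : E => Real.exp (inner ℝ θ x) • g x := by fun_prop
    exact this.comp_aestronglyMeasurable hX.aestronglyMeasurable
  refine hasFDerivAt_integral_of_dominated_of_fderiv_le (s := Metric.ball 0 δ)
    (bound := fun ω => ‖X ω‖ * Real.exp (δ * ‖X ω‖) * ‖g (X ω)‖)
    (F' := fun θ ω => Real.exp (inner ℝ θ (X ω)) • (innerSL ℝ (X ω)).smulRight (g (X ω)))
    (Metric.isOpen_ball.mem_nhds (by simpa using hθ₀)) (Eventually.of_forall hmeas) ?_ ?_ ?_ h1 ?_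
  · refine h0.mono' (hmeas θ₀) (ae_of_all _ fun ω => ?_)
    rw [norm_smul, Real.norm_eq_abs, Real.abs_exp]
    exact mul_le_mul_of_nonneg_right (hexp _ _ hθ₀) (norm_nonneg _)
  · have h2 : Continuous fun x : E =>
        Real.exp (inner ℝ θ₀ x) • (innerSL ℝ x).smulRight (g x) := by
      have h3 : Continuous fun x : E => (innerSL ℝ x).smulRight (g x) := by
        rw [continuous_clm_apply]
        intro y
        simp only [ContinuousLinearMap.smulRight_apply, innerSL_apply_apply]
        fun_prop
      fun_prop
    exact h2.comp_aestronglyMeasurable hX.aestronglyMeasurable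
  · refine ae_of_all _ fun ω θ hθ => ?_
    rw [norm_smul, Real.norm_eq_abs, Real.abs_exp, ContinuousLinearMap.norm_smulRight_apply,
      innerSL_apply_norm]
    have := mul_le_mul_of_nonneg_right (hexp θ (X ω) (by simpa using hθ))
      (mul_nonneg (norm_nonneg (X ω)) (norm_nonneg (g (X ω))))
    linarith
  · refine ae_of_all _ fun ω θ _ => ?_
    have h4 : HasFDerivAt (fun θ : E => (inner ℝ θ (X ω) : ℝ)) (innerSL ℝ (X ω)) θ := by
      have := (innerSL ℝ (X ω)).hasFDerivAt (x := θ)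
      have e : (fun θ : E => (inner ℝ θ (X ω) : ℝ)) = innerSL ℝ (X ω) := by
        funext y
        rw [innerSL_apply_apply, real_inner_comm]
      rwa [e]
    have h5 := h4.exp.smul_const (g (X ω))
    convert h5 using 1
    ext y
    simp [mul_smul]

theorem integral_smulRight_apply {E F : Type*} [NormedAddCommGroup E]
    [InnerProductSpace ℝ E] [FiniteDimensional ℝ E] [NormedAddCommGroup F] [NormedSpace ℝ F]
    [FiniteDimensional ℝ F] {X : Ω → E} (hX : AEStronglyMeasurable X P) {g : E → F}
    (hg : Continuous g) (hint : Integrable (fun ω => ‖X ω‖ * ‖g (X ω)‖) P) (u : E) :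
    (∫ ω, (innerSL ℝ (X ω)).smulRight (g (X ω)) ∂P) u = ∫ ω, (inner ℝ u (X ω) : ℝ) • g (X ω) ∂P := by
  have hi : Integrable (fun ω => (innerSL ℝ (X ω)).smulRight (g (X ω))) P := by
    refine hint.mono' ?_ (ae_of_all _ fun ω => ?_)
    · have h3 : Continuous fun x : E => (innerSL ℝ x).smulRight (g x) := by
        rw [continuous_clm_apply]
        intro y
        simp only [ContinuousLinearMap.smulRight_apply, innerSL_apply_apply]
        fun_prop
      exact h3.comp_aestronglyMeasurable hX
    · rw [ContinuousLinearMap.norm_smulRight_apply, innerSL_apply_norm]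
  have hcomm : ∀ ω, (inner ℝ u (X ω) : ℝ) = inner ℝ (X ω) u := fun ω => real_inner_comm _ _
  rw [ContinuousLinearMap.integral_apply hi]
  simp only [ContinuousLinearMap.smulRight_apply, innerSL_apply_apply, hcomm]

theorem integral_smulRight_innerSL_apply {E : Type*} [NormedAddCommGroup E]
    [InnerProductSpace ℝ E] [FiniteDimensional ℝ E] {X : Ω → E} (hX : MemLp X 2 P) (u v : E) :
    (∫ ω, (innerSL ℝ (X ω)).smulRight (innerSL ℝ (X ω)) ∂P) u v =
      ∫ ω, inner ℝ u (X ω) * inner ℝ v (X ω) ∂P := by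
  have hX2 := (memLp_two_iff_integrable_sq_norm hX.1).1 hX
  have h1 := integral_smulRight_apply hX.1 (g := fun x => innerSL ℝ x) (innerSL ℝ (E := E)).continuous
    (hX2.congr (ae_of_all _ fun ω => by simp [pow_two])) u
  rw [h1]
  have hcomm : ∀ ω, (inner ℝ v (X ω) : ℝ) = inner ℝ (X ω) v := fun ω => real_inner_comm _ _
  rw [ContinuousLinearMap.integral_apply]
  · simp only [smul_apply, innerSL_apply_apply, smul_eq_mul, hcomm]
  · refine (hX2.const_mul ‖u‖).mono' ?_ (ae_of_all _ fun ω => ?_)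
    · have h3 : Continuous fun x : E => (inner ℝ u x : ℝ) • innerSL ℝ x := by fun_prop
      exact h3.comp_aestronglyMeasurable hX.1
    · rw [norm_smul, innerSL_apply_norm, pow_two, ← mul_assoc]
      exact mul_le_mul_of_nonneg_right (norm_inner_le_norm _ _) (norm_nonneg _)

theorem dotProduct_hessian_mulVec {h : ℕ}
    (B : EuclideanSpace ℝ (Fin h) →L[ℝ] EuclideanSpace ℝ (Fin h) →L[ℝ] ℝ)
    (x : EuclideanSpace ℝ (Fin h)) :
    x.ofLp ⬝ᵥ (Matrix.of fun i j => B (EuclideanSpace.single i 1) (EuclideanSpace.single j 1)).mulVec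
      x.ofLp = B x x := by
  have hx : x = ∑ i, x i • EuclideanSpace.single i (1 : ℝ) := by
    ext k
    simp [Pi.single_apply]
  conv_rhs => rw [hx]
  simp only [map_sum, map_smul, sum_apply, smul_apply,
    smul_eq_mul, dotProduct, Matrix.mulVec, Matrix.of_apply, Finset.mul_sum]
  rw [Finset.sum_comm]
  refine Finset.sum_congr rfl fun i _ => Finset.sum_congr rfl fun j _ => ?_
  ring

variable [IsProbabilityMeasure P] {h : ℕ} {X : Ω → EuclideanSpace ℝ (Fin h)}

/-- First two derivatives of the cumulant generating function: the gradient at `0` is the mean and,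
for centered vectors, the Hessian at `0` is the matrix of second moments. -/
theorem vectorCgf_derivatives (hX : AEMeasurable X P)
    (hκ : ∀ᶠ θ : EuclideanSpace ℝ (Fin h) in 𝓝 0,
      Integrable (fun ω => Real.exp (inner ℝ θ (X ω))) P) :
    MemLp X 2 P ∧
    (∀ u, inner ℝ u (gradient (vectorCgf X P) 0) = ∫ ω, inner ℝ u (X ω) ∂P) ∧
    (gradient (vectorCgf X P) 0 = 0 → ∀ u v,
      fderiv ℝ (fderiv ℝ (vectorCgf X P)) 0 u v = ∫ ω, inner ℝ u (X ω) * inner ℝ v (X ω) ∂P) := by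
  obtain ⟨c, hc0, hc⟩ := exists_integrable_exp_norm hX hκ
  -- Differentiating twice needs ‖X‖² exp(δ ‖X‖) integrable, that is 3δ ≤ c.
  set δ := c / 3 with hδ
  have hδ0 : 0 < δ := by positivity
  have i0 := integrable_norm_pow_mul_exp hX hδ0 hc 0 (by norm_num; linarith)
  have i1 := integrable_norm_pow_mul_exp hX hδ0 hc 1 (by norm_num; linarith)
  have i2 := integrable_norm_pow_mul_exp hX hδ0 hc 2 (by norm_num; linarith)
  simp only [pow_zero, one_mul, pow_one] at i0 i1
  have hmem : MemLp X 2 P := by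
    rw [← memLp_norm_iff hX.aestronglyMeasurable, memLp_two_iff_integrable_sq (by fun_prop)]
    refine i2.mono' (by fun_prop) (ae_of_all _ fun ω => ?_)
    rw [Real.norm_of_nonneg (by positivity)]
    exact le_mul_of_one_le_right (by positivity) (Real.one_le_exp (by positivity))
  have hX1 : Integrable X P := hmem.integrable (by norm_num)
  set M : EuclideanSpace ℝ (Fin h) → ℝ := fun θ => ∫ ω, Real.exp (inner ℝ θ (X ω)) ∂P with hM
  set M' : EuclideanSpace ℝ (Fin h) → EuclideanSpace ℝ (Fin h) →L[ℝ] ℝ :=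
    fun θ => ∫ ω, Real.exp (inner ℝ θ (X ω)) • innerSL ℝ (X ω) ∂P with hM'
  have hd1 : ∀ θ, ‖θ‖ < δ → HasFDerivAt M (M' θ) θ := by
    intro θ hθ
    have := hasFDerivAt_integral_exp_inner_smul (P := P) hX (g := fun _ => (1 : ℝ))
      continuous_const (δ := δ) (by simpa using i0) (by simpa using i1) hθ
    have e : ∀ x : EuclideanSpace ℝ (Fin h), (innerSL ℝ x).smulRight (1 : ℝ) = innerSL ℝ x := by
      intro x; ext; simp
    simpa only [smul_eq_mul, mul_one, e] using this
  have hd2 := hasFDerivAt_integral_exp_inner_smul (P := P) hX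
    (g := fun x => innerSL ℝ x) (innerSL ℝ (E := EuclideanSpace ℝ (Fin h))).continuous (δ := δ)
    (by simpa [mul_comm] using i1)
    (i2.congr (ae_of_all _ fun ω => by simp; ring)) (θ₀ := 0) (by simpa using hδ0)
  simp only [inner_zero_left, Real.exp_zero, one_smul] at hd2
  have hM0 : M 0 = 1 := by simp [hM]
  have hM'0 : ∀ u, M' 0 u = ∫ ω, inner ℝ u (X ω) ∂P := by
    intro u
    have hi : Integrable (fun ω => innerSL ℝ (X ω)) P :=
      (innerSL ℝ (E := EuclideanSpace ℝ (Fin h))).integrable_comp hX1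
    simp only [hM', inner_zero_left, Real.exp_zero, one_smul]
    rw [ContinuousLinearMap.integral_apply hi]
    simp only [innerSL_apply_apply, real_inner_comm]
  have hnhds : ∀ᶠ θ : EuclideanSpace ℝ (Fin h) in 𝓝 0, ‖θ‖ < δ :=
    (continuous_norm.tendsto' 0 0 norm_zero).eventually (gt_mem_nhds hδ0)
  have hMc : ∀ᶠ θ in 𝓝 0, M θ ≠ 0 :=
    (hd1 0 (by simpa using hδ0)).continuousAt.eventually_ne (by simp [hM0])
  have hk1 : ∀ θ, ‖θ‖ < δ → M θ ≠ 0 → HasFDerivAt (vectorCgf X P) ((M θ)⁻¹ • M' θ) θ :=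
    fun θ hθ hne => (hd1 θ hθ).log hne
  have hk0 := hk1 0 (by simpa using hδ0) (by simp [hM0])
  rw [hM0, inv_one, one_smul] at hk0
  have hgrad : ∀ u, inner ℝ u (gradient (vectorCgf X P) 0) = M' 0 u := by
    intro u
    rw [gradient, hk0.fderiv, real_inner_comm, InnerProductSpace.toDual_symm_apply]
  refine ⟨hmem, fun u => (hgrad u).trans (hM'0 u), fun hzero u v => ?_⟩
  -- A vanishing mean kills the term from differentiating 1/M in (1/M) M', which leaves the second
  -- moment as the Hessian.
  have hM'z : M' 0 = 0 := by
    ext u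
    rw [← hgrad, hzero]
    simp
  have hev : fderiv ℝ (vectorCgf X P) =ᶠ[𝓝 0] fun θ => (M θ)⁻¹ • M' θ := by
    filter_upwards [hnhds, hMc] with θ h1 h2 using (hk1 θ h1 h2).fderiv
  have hinv : HasFDerivAt (fun θ => (M θ)⁻¹) (-((M 0 ^ 2)⁻¹) • M' 0) 0 :=
    (hasDerivAt_inv (by simp [hM0])).comp_hasFDerivAt 0 (hd1 0 (by simpa using hδ0))
  have hfin := hinv.smul hd2
  rw [hev.fderiv_eq]
  change fderiv ℝ (fun θ => (M θ)⁻¹ • M' θ) 0 u v = _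
  have hfin' : HasFDerivAt (fun θ => (M θ)⁻¹ • M' θ) _ 0 := hfin
  rw [hfin'.fderiv]
  rw [hM0, hM'z]
  simp only [inv_one, one_smul, smul_zero, add_apply,
    ContinuousLinearMap.smulRight_apply, zero_apply, zero_smul, add_zero]
  exact integral_smulRight_innerSL_apply hmem u v

end Moments

/-! ### Taylor expansion of characteristic functions at 0 -/

section Expansion

variable {Ω : Type*} [MeasurableSpace Ω] {P : Measure Ω} [IsProbabilityMeasure P] {h : ℕ}
  {X : Ω → EuclideanSpace ℝ (Fin h)}

/-- Second order expansion of a characteristic function along a line. -/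
theorem charFun_smul_sub_isLittleO (hX : AEMeasurable X P) (hmem : MemLp X 2 P)
    (ξ : EuclideanSpace ℝ (Fin h)) :
    (fun s : ℝ => charFun (P.map X) (s • ξ) -
      (1 + ((∫ ω, inner ℝ ξ (X ω) ∂P : ℝ) : ℂ) * s * Complex.I -
        ((∫ ω, inner ℝ ξ (X ω) * inner ℝ ξ (X ω) ∂P : ℝ) : ℂ) * s ^ 2 / 2)) =o[𝓝 0]
      fun s : ℝ => s ^ 2 := by
  have hY : AEMeasurable (fun ω => (inner ℝ ξ (X ω) : ℝ)) P := by fun_prop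
  have : IsProbabilityMeasure (P.map fun ω => (inner ℝ ξ (X ω) : ℝ)) :=
    Measure.isProbabilityMeasure_map hY
  have hYm : MemLp id 2 (P.map fun ω => (inner ℝ ξ (X ω) : ℝ)) := by
    rw [memLp_map_measure_iff (by fun_prop) hY]
    exact hmem.const_inner ξ
  -- Along a line only the real variable ⟨ξ, X⟩ matters, so the one-dimensional Taylor formula
  -- applies.
  have hchar : ∀ s : ℝ, charFun (P.map X) (s • ξ) =
      charFun (P.map fun ω => (inner ℝ ξ (X ω) : ℝ)) s := by
    intro s
    rw [charFun_apply, charFun_apply_real, integral_map hX (by fun_prop),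
      integral_map hY (by fun_prop)]
    refine integral_congr_ae (ae_of_all _ fun ω => ?_)
    simp only [inner_smul_right, real_inner_comm ξ (X ω)]
    push_cast
    ring_nf
  have htaylor := taylor_isLittleO_univ (x₀ := 0) (n := 2)
    (contDiff_charFun (n := 2) (by exact_mod_cast hYm))
  simp only [sub_zero, taylorWithinEval_charFun_two_zero hY hYm] at htaylor
  refine htaylor.congr_left fun s => ?_
  rw [hchar]
  simp only [Pi.pow_apply, pow_two]

/-- Diffusive scaling of the characteristic function of a centered random vector. -/
theorem tendsto_mul_charFun_sub_one_of_centered (hX : AEMeasurable X P) (hmem : MemLp X 2 P)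
    (ξ : EuclideanSpace ℝ (Fin h)) (hmean : ∫ ω, inner ℝ ξ (X ω) ∂P = 0) :
    Tendsto (fun r : ℝ≥0 => (r : ℂ) * (charFun (P.map X) ((r : ℝ) ^ (-(1 / 2) : ℝ) • ξ) - 1)) atTop
      (𝓝 (-((∫ ω, inner ℝ ξ (X ω) * inner ℝ ξ (X ω) ∂P : ℝ) : ℂ) / 2)) := by
  have ho := charFun_smul_sub_isLittleO hX hmem ξ
  rw [hmean] at ho
  have ha : Tendsto (fun r : ℝ≥0 => (r : ℝ) ^ (-(1 / 2) : ℝ)) atTop (𝓝 0) :=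
    (tendsto_rpow_neg_atTop (y := 1 / 2) (by norm_num)).comp (NNReal.tendsto_coe_atTop.2 tendsto_id)
  -- With s = r^(-1/2), dividing by s² is multiplying by r; the linear term is absent because the
  -- mean vanishes.
  have h1 := (ho.comp_tendsto ha).tendsto_inv_smul_nhds_zero
  rw [← tendsto_sub_nhds_zero_iff]
  refine h1.congr' ?_
  filter_upwards [eventually_gt_atTop 0] with r hr
  have hr' : (0 : ℝ) < r := hr
  have hsq : ((r : ℝ) ^ (-(1 / 2) : ℝ)) ^ 2 = (r : ℝ)⁻¹ := by
    rw [← Real.rpow_natCast, ← Real.rpow_mul hr'.le, ← Real.rpow_neg_one]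
    norm_num
  have hsqC : (((r : ℝ) ^ (-(1 / 2) : ℝ) : ℝ) : ℂ) ^ 2 = ((r : ℝ) : ℂ)⁻¹ := by
    rw [← Complex.ofReal_pow, hsq, Complex.ofReal_inv]
  have hrC : ((r : ℝ) : ℂ) ≠ 0 := by exact_mod_cast hr'.ne'
  simp only [Function.comp, hsq, hsqC, inv_inv, Complex.real_smul, Complex.ofReal_zero]
  field_simp
  ring

/-- Linear scaling of the characteristic function of a random vector. -/
theorem tendsto_mul_charFun_sub_one (hX : AEMeasurable X P) (hmem : MemLp X 2 P)
    (ξ : EuclideanSpace ℝ (Fin h)) :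
    Tendsto (fun r : ℝ≥0 => (r : ℂ) * (charFun (P.map X) ((r : ℝ) ^ (-1 : ℝ) • ξ) - 1)) atTop
      (𝓝 (((∫ ω, inner ℝ ξ (X ω) ∂P : ℝ) : ℂ) * Complex.I)) := by
  have ho := charFun_smul_sub_isLittleO hX hmem ξ
  have ha : Tendsto (fun r : ℝ≥0 => (r : ℝ) ^ (-1 : ℝ)) atTop (𝓝 0) :=
    (tendsto_rpow_neg_atTop one_pos).comp (NNReal.tendsto_coe_atTop.2 tendsto_id)
  have haC : Tendsto (fun r : ℝ≥0 => (((r : ℝ) ^ (-1 : ℝ) : ℝ) : ℂ)) atTop (𝓝 0) := by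
    simpa [Function.comp_def] using (Complex.continuous_ofReal.tendsto 0).comp ha
  -- With s = 1/r, multiplying by r is dividing by s: the remainder becomes s · o(1) and the
  -- quadratic term O(s), so only the mean survives.
  have h1 := (haC.mul (ho.comp_tendsto ha).tendsto_inv_smul_nhds_zero).sub
    (haC.const_mul (((∫ ω, inner ℝ ξ (X ω) * inner ℝ ξ (X ω) ∂P : ℝ) : ℂ) / 2))
  rw [mul_zero, mul_zero, sub_zero] at h1
  rw [← tendsto_sub_nhds_zero_iff]
  refine h1.congr' ?_
  filter_upwards [eventually_gt_atTop 0] with r hr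
  have hr' : (0 : ℝ) < r := hr
  have hrC : ((r : ℝ) : ℂ) ≠ 0 := by exact_mod_cast hr'.ne'
  simp only [Function.comp, Real.rpow_neg_one, inv_pow, inv_inv, Complex.real_smul,
    Complex.ofReal_inv, Complex.ofReal_pow]
  field_simp
  ring

end Expansion

/-! ### The time-changed process -/

section Limit

variable {Ω : Type*} [MeasurableSpace Ω] {P : Measure Ω} [IsProbabilityMeasure P] {h : ℕ}
  {S : ℝ≥0 → Ω → EuclideanSpace ℝ (Fin h)} {L : ℝ≥0 → Ω → ℝ≥0} {ν : ℝ}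

/-- Self-similarity moves the dependence on t from the law of L t into the integrand, so dominated
convergence runs against the fixed law of L 1. -/
theorem tendsto_charFun_timeChanged (hν : 0 < ν) (hS : IsLevyProcess S P)
    (hL : IsInverseStableSubordinator ν L P)
    (hSL : IndepFun (fun ω t => S t ω) (fun ω t => L t ω) P) {δ : ℝ} (hδ : 0 < δ)
    {ξ : EuclideanSpace ℝ (Fin h)} {c : ℂ}
    (hc : Tendsto (fun r : ℝ≥0 => (r : ℂ) * (charFun (P.map (S 1)) ((r : ℝ) ^ (-δ) • ξ) - 1))
      atTop (𝓝 c)) :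
    Tendsto (fun t : ℝ≥0 => charFun (P.map fun ω => (t : ℝ) ^ (-(ν * δ)) • S (L t ω) ω) ξ) atTop
      (𝓝 (∫ l, Complex.exp (l * c) ∂(P.map (L 1)))) := by
  have mL := hL.measurable
  have : IsProbabilityMeasure (P.map (L 1)) := Measure.isProbabilityMeasure_map (mL 1).aemeasurable
  have hr : Tendsto (fun t : ℝ≥0 => t ^ ν) atTop atTop := NNReal.tendsto_rpow_atTop hν
  have hη0 : Tendsto (fun r : ℝ≥0 => (r : ℝ) ^ (-δ) • ξ) atTop (𝓝 0) := by
    have := (((tendsto_rpow_neg_atTop hδ).comp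
      (NNReal.tendsto_coe_atTop.2 tendsto_id)).smul_const ξ)
    simpa [Function.comp_def] using this
  have hmain : Tendsto (fun t : ℝ≥0 => ∫ l, charFun (P.map (S (t ^ ν * l)))
      (((t ^ ν : ℝ≥0) : ℝ) ^ (-δ) • ξ) ∂(P.map (L 1))) atTop
      (𝓝 (∫ l, Complex.exp (l * c) ∂(P.map (L 1)))) := by
    refine tendsto_integral_filter_of_dominated_convergence (fun _ => 1)
      (Eventually.of_forall fun t => ?_) (Eventually.of_forall fun t => ae_of_all _ fun l => ?_)
      (integrable_const _) (ae_of_all _ fun l => ?_)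
    · exact ((hS.measurable_charFun _).comp
        (measurable_const.mul measurable_id)).aestronglyMeasurable
    · exact norm_charFun_map_le_one (hS.measurable _).aemeasurable _
    · exact hS.tendsto_charFun_scaling (hη0.comp hr) hr (hc.comp hr) l
  refine hmain.congr' ?_
  filter_upwards [eventually_gt_atTop 0] with t ht
  have hscale : ((t ^ ν : ℝ≥0) : ℝ) ^ (-δ) = (t : ℝ) ^ (-(ν * δ)) := by
    rw [NNReal.coe_rpow, ← Real.rpow_mul t.coe_nonneg, mul_neg]
  have hind : IndepFun (fun ω t => S t ω) (L t) P := hSL.comp measurable_id (measurable_pi_apply t)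
  have hm := charFun_map_smul_comp (hS.aemeasurable_eval (mL t)) ((t : ℝ) ^ (-(ν * δ))) ξ
  rw [hscale, hm,
    hS.charFun_eval_indep (mL t) hind, hL.map_eq_map_mul hν ht,
    integral_map ((mL 1).const_mul _).aemeasurable (hS.measurable_charFun _).aestronglyMeasurable,
    integral_map (mL 1).aemeasurable]
  exact ((hS.measurable_charFun _).comp (measurable_const.mul measurable_id)).aestronglyMeasurable

theorem tendstoInDistribution_timeChanged (hν : 0 < ν) (hS : IsLevyProcess S P)
    (hL : IsInverseStableSubordinator ν L P)
    (hSL : IndepFun (fun ω t => S t ω) (fun ω t => L t ω) P) {δ α : ℝ} (hδ : 0 < δ)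
    (hα : α = 1 - ν * δ) {ψ : EuclideanSpace ℝ (Fin h) → ℂ}
    (hψ : ∀ ξ, Tendsto
      (fun r : ℝ≥0 => (r : ℂ) * (charFun (P.map (S 1)) ((r : ℝ) ^ (-δ) • ξ) - 1)) atTop (𝓝 (ψ ξ)))
    {Ω' : Type*} [MeasurableSpace Ω'] {P' : Measure Ω'} [IsProbabilityMeasure P']
    {Z : Ω' → EuclideanSpace ℝ (Fin h)} (hZ : AEMeasurable Z P')
    (hZψ : ∀ ξ, charFun (P'.map Z) ξ = ∫ l, Complex.exp (l * ψ ξ) ∂(P.map (L 1))) :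
    TendstoInDistribution (fun (t : ℝ≥0) ω => (t : ℝ) ^ α • ((t : ℝ)⁻¹ • S (L t ω) ω))
      atTop Z (fun _ => P) P' where
  forall_aemeasurable t := by
    exact ((hS.aemeasurable_eval (hL.measurable t)).const_smul ((t : ℝ)⁻¹)).const_smul
      ((t : ℝ) ^ α)
  aemeasurable_limit := hZ
  tendsto := by
    -- The continuity theorem is applied along sequences of times tending to infinity.
    refine tendsto_of_seq_tendsto fun u hu => ?_
    refine ProbabilityMeasure.tendsto_of_tendsto_charFun fun ξ => ?_
    have h1 := (tendsto_charFun_timeChanged hν hS hL hSL hδ (hψ ξ)).comp hu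
    rw [← hZψ] at h1
    refine h1.congr' ?_
    filter_upwards [hu.eventually_gt_atTop 0] with n hn
    have hn' : (0 : ℝ) < u n := hn
    have hpow : ((u n : ℝ≥0) : ℝ) ^ α * (u n : ℝ)⁻¹ = (u n : ℝ) ^ (-(ν * δ)) := by
      rw [← Real.rpow_neg_one, ← Real.rpow_add hn', hα]
      ring_nf
    simp only [Function.comp, ProbabilityMeasure.coe_mk, smul_smul, hpow]

end Limit

/-! ### Identification of the two limits -/

theorem mainTheorem5 {h : ℕ} {ν : ℝ} (hν : ν ∈ Set.Ioo (0 : ℝ) 1)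
    {Ω : Type*} [MeasurableSpace Ω] (P : Measure Ω) [IsProbabilityMeasure P]
    (S : ℝ≥0 → Ω → EuclideanSpace ℝ (Fin h)) (hS : IsLevyProcess S P)
    (hκ : ∀ᶠ θ : EuclideanSpace ℝ (Fin h) in 𝓝 0,
      Integrable (fun ω => Real.exp (inner ℝ θ (S 1 ω))) P)
    (L : ℝ≥0 → Ω → ℝ≥0) (hL : IsInverseStableSubordinator ν L P)
    (hSL : IndepFun (fun ω t => S t ω) (fun ω t => L t ω) P) :
    (gradient (vectorCgf (S 1) P) 0 = 0 →
      ∃ (Ω' : Type) (_ : MeasurableSpace Ω') (P' : Measure Ω') (_ : IsProbabilityMeasure P')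
        (Λ : Ω' → ℝ≥0) (Z : Ω' → EuclideanSpace ℝ (Fin h)),
        HasLaw Λ (P.map (L 1)) P' ∧
        HasCondDistrib Z Λ (gaussianScaleKernel (hessianMatrix (vectorCgf (S 1) P) 0)) P' ∧
        TendstoInDistribution
          (fun (t : ℝ≥0) ω =>
            (t : ℝ) ^ scalingExponent ν (gradient (vectorCgf (S 1) P) 0) •
              ((t : ℝ)⁻¹ • S (L t ω) ω))
          atTop Z (fun _ => P) P') ∧
    (gradient (vectorCgf (S 1) P) 0 ≠ 0 →
      TendstoInDistribution
        (fun (t : ℝ≥0) ω =>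
          (t : ℝ) ^ scalingExponent ν (gradient (vectorCgf (S 1) P) 0) •
            ((t : ℝ)⁻¹ • S (L t ω) ω))
        atTop (fun ω => (L 1 ω : ℝ) • gradient (vectorCgf (S 1) P) 0) (fun _ => P) P) := by
  have mS := (hS.measurable 1).aemeasurable (μ := P)
  have mL := hL.measurable 1
  have hLp : IsProbabilityMeasure (P.map (L 1)) := Measure.isProbabilityMeasure_map mL.aemeasurable
  obtain ⟨hmem, hmean, hhess⟩ := vectorCgf_derivatives mS hκ
  refine ⟨fun hzero => ?_, fun hne => ?_⟩
  · set Q := hessianMatrix (vectorCgf (S 1) P) 0 with hQ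
    have hquad : ∀ ξ : EuclideanSpace ℝ (Fin h), ξ.ofLp ⬝ᵥ Q.mulVec ξ.ofLp =
        ∫ ω, inner ℝ ξ (S 1 ω) * inner ℝ ξ (S 1 ω) ∂P := fun ξ => by
      rw [hQ, hessianMatrix, dotProduct_hessian_mulVec, hhess hzero]
    -- Positivity is needed for the Gaussian characteristic function formula; the quadratic form of
    -- Q is E⟨ξ, S 1⟩².
    have hpsd : Q.PosSemidef := by
      refine Matrix.PosSemidef.of_dotProduct_mulVec_nonneg ?_ fun x => ?_
      · ext i j
        simp only [hQ, hessianMatrix, Matrix.conjTranspose_apply, Matrix.of_apply, star_trivial,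
          hhess hzero, mul_comm]
      · have := hquad (WithLp.toLp 2 x)
        simp only [star_trivial] at this ⊢
        rw [this]
        exact integral_nonneg fun ω => mul_self_nonneg _
    -- The mixture is realised canonically: draw l from the law of L 1, then a vector from N(0, lQ),
    -- and take the two coordinates.
    refine ⟨ℝ≥0 × EuclideanSpace ℝ (Fin h), inferInstance, P.map (L 1) ⊗ₘ gaussianScaleKernel Q,
      inferInstance, Prod.fst, Prod.snd, ⟨by fun_prop, Measure.fst_compProd _ _⟩, ?_, ?_⟩
    · refine ⟨by fun_prop, ?_⟩
      have h1 : (P.map (L 1) ⊗ₘ gaussianScaleKernel Q).map Prod.fst = P.map (L 1) :=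
        Measure.fst_compProd _ _
      rw [h1]
      exact Measure.map_id
    · refine tendstoInDistribution_timeChanged hν.1 hS hL hSL (δ := 1 / 2) (by norm_num) ?_
        (fun ξ => tendsto_mul_charFun_sub_one_of_centered mS hmem ξ ?_) (by fun_prop) fun ξ => ?_
      · rw [scalingExponent, if_pos hzero]
        ring
      · rw [← hmean, hzero, inner_zero_right]
      · have hint : Integrable (fun p : ℝ≥0 × EuclideanSpace ℝ (Fin h) =>
            Complex.exp (inner ℝ p.2 ξ * Complex.I)) (P.map (L 1) ⊗ₘ gaussianScaleKernel Q) := by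
          refine Integrable.of_bound (C := 1) (by fun_prop) (ae_of_all _ fun p => ?_)
          rw [Complex.norm_exp_ofReal_mul_I]
        rw [charFun_apply, integral_map (by fun_prop) (by fun_prop),
          Measure.integral_compProd hint]
        refine integral_congr_ae (ae_of_all _ fun l => ?_)
        -- Given l, the characteristic function is exp(-l⟨ξ, Qξ⟩/2), which is exp(l ψ(ξ)) for the
        -- diffusive exponent.
        have h2 := charFun_multivariateGaussian (μ := (0 : EuclideanSpace ℝ (Fin h)))
          (hpsd.smul l.coe_nonneg) ξ
        rw [charFun_apply] at h2
        change ∫ x, Complex.exp (inner ℝ x ξ * Complex.I)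
          ∂(multivariateGaussian 0 ((l : ℝ) • Q)) = _
        rw [h2, Matrix.smul_mulVec, dotProduct_smul, hquad]
        simp only [inner_zero_right, smul_eq_mul]
        push_cast
        ring_nf
  · refine tendstoInDistribution_timeChanged hν.1 hS hL hSL (δ := 1) one_pos ?_
      (fun ξ => tendsto_mul_charFun_sub_one mS hmem ξ) ?_ fun ξ => ?_
    · rw [scalingExponent, if_neg hne, mul_one]
    · fun_prop
    · rw [charFun_apply, integral_map (by fun_prop) (by fun_prop),
        integral_map mL.aemeasurable (by fun_prop)]
      refine integral_congr_ae (ae_of_all _ fun ω => ?_)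
      simp only [← hmean, inner_smul_left, real_inner_comm]
      push_cast
      simp [mul_assoc]
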